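/- Let $(R,\mathfrak m)$ be a Noetherian local ring of Krull dimension $d$, and let $I_1,\dots,I_r$ be ideals of $R$. Then there exist a numerical polynomial $F\in\mathbb{Q}[x_1,\dots,x_r]$ (that is, a polynomial with rational coefficients taking integer values at all points of $\mathbb{Z}^r$) of total degree at most $d$ and an integer $N\ge 0$ such that, for all integers $n_1,\dots,n_r\ge N$, the $0$-th local cohomology module $H^0_{\mathfrak m}\bigl(R/I_1^{n_1}\cdots I_r^{n_r}\bigr)$ has finite length and $$\ell_R\Bigl(H^0_{\mathfrak m}\bigl(R/I_1^{n_1}\cdots I_r^{n_r}\bigr)\Bigr)\le F(n_1,\dots,n_r).$$ -/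

import Mathlib

/-- A polynomial with rational coefficients is *numerical* if it takes integer values
at all integer points. -/
def MvPolynomial.IsNumerical {σ : Type*} (F : MvPolynomial σ ℚ) : Prop :=
  ∀ n : σ → ℤ, ∃ z : ℤ, MvPolynomial.eval (fun i => (n i : ℚ)) F = (z : ℚ)

/-! Write Q for the product of the `I i ^ n i` and |n| for the sum of the `n i`. One constant c,
independent of n, makes every 𝔪-power torsion element of R/Q that lifts to 𝔪^(c|n|) vanish. The
torsion thus has length at most ℓ(R/𝔪^(c|n|)) ≤ C(c|n|)^d, and F is this last expression.

To find c, pass to a Noetherian extended Rees algebra, where each `I i` extends into the ideal of a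
nonzerodivisor `u i` and the ideal of ∏ `u i ^ n i` contracts into Q
(`Ideal.exists_mem_prod_pow_of_mem_pow`). There, Artin–Rees lets one factor `u i` be divided out at
a bounded cost in powers of J, and |n| divisions suffice
(`Ideal.exists_mem_span_prod_pow_of_mem_pow`). -/

/-- A linear Artin–Rees type bound: modulo a monomial in nonzerodivisors, torsion supported on `V(J)`
does not meet a power of `J` that grows linearly with the degree of the monomial. -/
theorem Ideal.exists_mem_span_prod_pow_of_mem_pow {S : Type*} [CommRing S] [IsNoetherianRing S]
    {ι : Type*} [Fintype ι] (u : ι → S) (hu : ∀ i, u i ∈ nonZeroDivisors S) (J : Ideal S) :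
    ∃ c : ℕ, ∀ (n : ι → ℕ) (y : S), (∃ k, ∀ a ∈ J ^ k, a * y ∈ Ideal.span {∏ i, u i ^ n i}) →
      y ∈ J ^ (c * ∑ i, n i) → y ∈ Ideal.span {∏ i, u i ^ n i} := by
  classical
  have key : ∀ i, ∃ c : ℕ, ∀ (m : ℕ) (y : S), c ≤ m → y ∈ J ^ m →
      (∃ k, ∀ a ∈ J ^ k, a * y ∈ Ideal.span {u i}) → ∃ z ∈ J ^ (m - c), y = u i * z := by
    intro i
    -- The chain of colons stabilizes at T, the J-power torsion modulo `u i`, so one power J^K sends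
    -- all of T into (`u i`).
    have hmono : Monotone fun k : ℕ => (Ideal.span {u i}).colon ((J ^ k : Ideal S) : Set S) := by
      intro a b hab
      exact Submodule.colon_mono le_rfl (Ideal.pow_le_pow_right hab)
    obtain ⟨K, hK⟩ := monotone_stabilizes_iff_noetherian.mpr (inferInstanceAs (IsNoetherian S S))
      ⟨_, hmono⟩
    let T : Ideal S := (Ideal.span {u i}).colon ((J ^ K : Ideal S) : Set S)
    have hT : J ^ K * T ≤ Ideal.span {u i} := by
      rw [Ideal.mul_le]
      intro a ha t ht
      have := Submodule.mem_colon.mp ht a ha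
      rwa [smul_eq_mul, mul_comm] at this
    obtain ⟨e, he⟩ := J.exists_pow_inf_eq_pow_smul T
    refine ⟨e + K, fun m y hm hy ⟨k, hk⟩ => ?_⟩
    have hyT : y ∈ T := by
      have h1 : y ∈ (Ideal.span {u i}).colon ((J ^ (max k K) : Ideal S) : Set S) := by
        refine hmono (le_max_left k K) (Submodule.mem_colon.mpr fun a ha => ?_)
        rw [smul_eq_mul, mul_comm]
        exact hk a ha
      have h2 := hK (max k K) (le_max_right k K)
      simp only [OrderHom.coe_mk] at h2
      change y ∈ (Ideal.span {u i}).colon ((J ^ K : Ideal S) : Set S)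
      rw [h2]
      exact h1
    have h3 : y ∈ J ^ m • (⊤ : Ideal S) ⊓ T := ⟨by simpa using hy, hyT⟩
    rw [he m (by omega)] at h3
    -- Artin–Rees has cost e powers of J; K more are spent to push T into (`u i`), hence the
    -- constant e + K.
    have h4 : J ^ (m - e) • (J ^ e • (⊤ : Ideal S) ⊓ T) ≤ Ideal.span {u i} * J ^ (m - (e + K)) := by
      rw [show m - e = (m - (e + K)) + K by omega, pow_add, smul_eq_mul, mul_assoc, mul_comm]
      exact Ideal.mul_mono_left ((Ideal.mul_mono_right inf_le_right).trans hT)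
    obtain ⟨z, hz, rfl⟩ := Ideal.mem_span_singleton_mul.mp (h4 h3)
    exact ⟨z, hz, rfl⟩
  choose c hc using key
  -- Any common upper bound of the `c i` works: each division by some `u i` then costs at most that
  -- many powers of J.
  refine ⟨∑ i, c i, fun n => ?_⟩
  induction h : ∑ i, n i generalizing n with
  | zero =>
    intro y _ _
    have : ∀ i, n i = 0 := by simpa using h
    simp [this]
  | succ N ih =>
    intro y ⟨k, hk⟩ hy
    obtain ⟨i, hi⟩ : ∃ i, n i ≠ 0 := by
      by_contra! h0
      simp [h0] at h
    let n' := Function.update n i (n i - 1)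
    have hprod : ∏ j, u j ^ n j = u i * ∏ j, u j ^ n' j := by
      rw [← Finset.mul_prod_erase _ _ (Finset.mem_univ i),
        ← Finset.mul_prod_erase _ (fun j => u j ^ n' j) (Finset.mem_univ i), ← mul_assoc,
        show n' i = n i - 1 by simp [n'], ← pow_succ', Nat.sub_add_cancel (by omega)]
      congr 1
      refine Finset.prod_congr rfl fun j hj => ?_
      simp [n', Finset.ne_of_mem_erase hj]
    have hsum : ∑ j, n' j = N := by
      have h1 := Finset.add_sum_erase Finset.univ n (Finset.mem_univ i)
      have h2 := Finset.add_sum_erase Finset.univ n' (Finset.mem_univ i)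
      have h3 : ∑ j ∈ Finset.univ.erase i, n j = ∑ j ∈ Finset.univ.erase i, n' j :=
        Finset.sum_congr rfl fun j hj => by simp [n', Finset.ne_of_mem_erase hj]
      have h4 : n' i = n i - 1 := by simp [n']
      omega
    have hci : c i ≤ ∑ i, c i := Finset.single_le_sum (fun _ _ => Nat.zero_le _) (Finset.mem_univ i)
    obtain ⟨z, hz, rfl⟩ := hc i _ y (hci.trans (Nat.le_mul_of_pos_right _ N.succ_pos)) hy
      ⟨k, fun a ha => by
        have := hk a ha
        rw [hprod, Ideal.mem_span_singleton] at this
        exact Ideal.mem_span_singleton.mpr ((dvd_mul_right _ _).trans this)⟩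
    rw [hprod, Ideal.mem_span_singleton]
    refine mul_dvd_mul_left _ (Ideal.mem_span_singleton.mp (ih n' hsum z ⟨k, fun a ha => ?_⟩
      (Ideal.pow_le_pow_right ?_ hz)))
    · have := hk a ha
      rw [hprod, Ideal.mem_span_singleton] at this
      obtain ⟨w, hw⟩ := this
      refine Ideal.mem_span_singleton.mpr ⟨w, ?_⟩
      have h0 : u i * (a * z - (∏ j, u j ^ n' j) * w) = 0 := by linear_combination hw
      exact sub_eq_zero.mp ((mul_left_mem_nonZeroDivisors_eq_zero_iff (hu i)).mp h0)
    · rw [Nat.mul_succ]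
      omega

/-! ### Hilbert–Samuel bound -/

/-- Multiplication by x maps R/(y, J) onto the kernel of R/(xy, J) → R/(x, J). -/
theorem Ideal.length_quotient_span_mul_sup_le {R : Type*} [CommRing R] (x y : R) (J : Ideal R) :
    Module.length R (R ⧸ (Ideal.span {x * y} ⊔ J)) ≤
      Module.length R (R ⧸ (Ideal.span {x} ⊔ J)) + Module.length R (R ⧸ (Ideal.span {y} ⊔ J)) := by
  let A := Ideal.span {x * y} ⊔ J
  let f : (R ⧸ (Ideal.span {y} ⊔ J)) →ₗ[R] (R ⧸ A) :=
    Submodule.mapQ _ _ (LinearMap.mulLeft R x) (by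
      rw [sup_le_iff, Ideal.span_singleton_le_iff_mem]
      refine ⟨Ideal.mem_sup_left (Ideal.mem_span_singleton_self _), fun a ha => ?_⟩
      exact Ideal.mem_sup_right (J.mul_mem_left x ha))
  have hA : A ≤ Ideal.span {x} ⊔ J := by
    refine sup_le_sup_right ?_ _
    rw [Ideal.span_singleton_le_span_singleton]
    exact dvd_mul_right _ _
  let g : (R ⧸ A) →ₗ[R] (R ⧸ (Ideal.span {x} ⊔ J)) := Submodule.factor hA
  have hg : Function.Surjective g := Submodule.factor_surjective hA
  have hfg : Function.Exact (LinearMap.range f).subtype g := by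
    intro a
    obtain ⟨a, rfl⟩ := Submodule.Quotient.mk_surjective _ a
    have hga : g (Submodule.Quotient.mk a) = Submodule.Quotient.mk a := rfl
    rw [hga, Submodule.Quotient.mk_eq_zero]
    simp only [Set.mem_range, Subtype.exists, LinearMap.mem_range, Submodule.subtype_apply,
      exists_prop, exists_eq_right]
    constructor
    · intro ha
      obtain ⟨b, hb, j, hj, rfl⟩ := Submodule.mem_sup.mp ha
      obtain ⟨b, rfl⟩ := Ideal.mem_span_singleton.mp hb
      refine ⟨Submodule.Quotient.mk b, (Submodule.Quotient.eq _).mpr ?_⟩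
      refine Ideal.mem_sup_right ?_
      simpa using hj
    · rintro ⟨b, hb⟩
      obtain ⟨b, rfl⟩ := Submodule.Quotient.mk_surjective _ b
      have h1 : x * b - a ∈ A := (Submodule.Quotient.eq _).mp hb
      have h2 : x * b ∈ Ideal.span {x} ⊔ J :=
        Ideal.mem_sup_left (Ideal.mem_span_singleton.mpr (dvd_mul_right _ _))
      simpa using sub_mem h2 (hA h1)
  rw [Module.length_eq_add_of_exact _ _ (LinearMap.range f).injective_subtype hg hfg, add_comm]
  gcongr
  exact Module.length_le_of_surjective f.rangeRestrict f.surjective_rangeRestrict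

theorem Ideal.length_quotient_span_pow_sup_le {R : Type*} [CommRing R] (x : R) (J : Ideal R)
    (k : ℕ) :
    Module.length R (R ⧸ (Ideal.span {x ^ k} ⊔ J)) ≤
      k * Module.length R (R ⧸ (Ideal.span {x} ⊔ J)) := by
  induction k with
  | zero =>
    have : Ideal.span {x ^ 0} ⊔ J = ⊤ := by simp
    rw [this]
    simp
  | succ k ih =>
    rw [pow_succ]
    refine (Ideal.length_quotient_span_mul_sup_le _ _ _).trans ?_
    push_cast
    rw [add_mul, one_mul]
    gcongr

theorem Ideal.length_quotient_span_image_pow_sup_le {R : Type*} [CommRing R] (k : ℕ)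
    (s : Finset R) (J : Ideal R) :
    Module.length R (R ⧸ (Ideal.span ((· ^ k) '' (s : Set R)) ⊔ J)) ≤
      (k ^ s.card : ℕ) * Module.length R (R ⧸ (Ideal.span (s : Set R) ⊔ J)) := by
  classical
  induction s using Finset.induction_on generalizing J with
  | empty =>
    rw [Finset.coe_empty, Set.image_empty, Finset.card_empty, pow_zero, Nat.cast_one, one_mul]
  | insert x s hx ih =>
    rw [Finset.coe_insert, Set.image_insert_eq, Ideal.span_insert, Ideal.span_insert, sup_assoc,
      Finset.card_insert_of_notMem hx, pow_succ', Nat.cast_mul, mul_assoc]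
    refine (Ideal.length_quotient_span_pow_sup_le _ _ _).trans ?_
    gcongr
    rw [sup_left_comm, sup_assoc, sup_left_comm (Ideal.span {x})]
    exact ih _

/-- The Hilbert–Samuel function of a Noetherian local ring of dimension `d` is `O(k ^ d)`. -/
theorem IsLocalRing.exists_length_quotient_maximalIdeal_pow_le {R : Type*} [CommRing R]
    [IsLocalRing R] [IsNoetherianRing R] (d : ℕ) (hd : ringKrullDim R = (d : WithBot ℕ∞)) :
    ∃ C : ℕ, ∀ k : ℕ,
      Module.length R (R ⧸ IsLocalRing.maximalIdeal R ^ k) ≤ ((C * k ^ d : ℕ) : ℕ∞) := by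
  obtain ⟨s, hs, hcard⟩ :=
    (IsLocalRing.maximalIdeal R).exists_finset_card_eq_height_of_isNoetherianRing
  have hh : (IsLocalRing.maximalIdeal R).height = d := by
    have := IsLocalRing.maximalIdeal_height_eq_ringKrullDim (R := R)
    rw [hd] at this
    exact_mod_cast this
  have hsd : s.card = d := by
    rw [hh] at hcard
    exact_mod_cast hcard
  have hle : Ideal.span (s : Set R) ≤ IsLocalRing.maximalIdeal R := hs.1.2
  have hart : IsArtinianRing (R ⧸ Ideal.span (s : Set R)) :=
    IsLocalRing.quotient_artinian_of_mem_minimalPrimes_of_isLocalRing _ hs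
  have hfin : Module.length R (R ⧸ Ideal.span (s : Set R)) ≠ ⊤ := by
    rw [Module.length_eq_of_surjective (S := R) (R := R ⧸ Ideal.span (s : Set R))
      Ideal.Quotient.mk_surjective]
    exact Module.length_ne_top
  obtain ⟨C, hC⟩ := ENat.ne_top_iff_exists.mp hfin
  refine ⟨C, fun k => ?_⟩
  -- R/𝔪^k is a quotient of R modulo the k-th powers of d parameters; C is the length of R modulo
  -- the parameters.
  have hk : Ideal.span ((· ^ k) '' (s : Set R)) ≤ IsLocalRing.maximalIdeal R ^ k := by
    rw [Ideal.span_le]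
    rintro _ ⟨x, hx, rfl⟩
    exact Ideal.pow_mem_pow (hle (Ideal.subset_span hx)) k
  have h := Ideal.length_quotient_span_image_pow_sup_le k s (⊥ : Ideal R)
  rw [sup_bot_eq, sup_bot_eq, ← hC, hsd] at h
  refine (Module.length_le_of_surjective (Submodule.factor hk)
    (Submodule.factor_surjective hk)).trans (h.trans ?_)
  rw [← Nat.cast_mul, mul_comm]

-- Length of zeroth local cohomology

universe u

open CategoryTheory in
-- Left exactness of Hom, checked on underlying sets; it identifies the zeroth derived functor with
-- Hom.
instance CategoryTheory.linearYoneda_obj_preservesFiniteLimits {R : Type*} [Ring R]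
    {C : Type*} [Category* C] [Preadditive C] [Linear R C] (Y : C) :
    Limits.PreservesFiniteLimits ((linearYoneda R C).obj Y) := by
  have : Limits.PreservesFiniteLimits ((linearYoneda R C).obj Y ⋙ forget (ModuleCat R)) :=
    inferInstanceAs (Limits.PreservesFiniteLimits (yoneda.obj Y))
  exact Limits.preservesFiniteLimits_of_reflects_of_preserves _ (forget (ModuleCat R))

open CategoryTheory in
/-- `Ext⁰` is `Hom`. -/
noncomputable def extZeroIso (R : Type*) [Ring R] {C : Type*} [Category* C] [Abelian C]
    [Linear R C] [EnoughProjectives C] (X Y : C) :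
    ((Ext R C 0).obj (Opposite.op X)).obj Y ≅ ModuleCat.of R (X ⟶ Y) :=
  have := Limits.preservesFiniteColimits_rightOp ((linearYoneda R C).obj Y)
  (((linearYoneda R C).obj Y).rightOp.leftDerivedZeroIsoSelf.app X).unop.symm

/-- A directed union of submodules of bounded length has bounded length. -/
theorem Module.length_le_of_directed {R M ι : Type*} [Ring R] [AddCommGroup M] [Module R M]
    [Nonempty ι] (P : ι → Submodule R M) (hP : Directed (· ≤ ·) P) (htop : ∀ x, ∃ i, x ∈ P i)
    (B : ℕ) (hB : ∀ i, Module.length R (P i) ≤ B) : Module.length R M ≤ B := by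
  have hl : ∀ i, ∃ l : ℕ, Module.length R (P i) = l := fun i => by
    obtain ⟨l, hl⟩ := ENat.ne_top_iff_exists.mp (ne_top_of_le_ne_top (ENat.natCast_ne_top B) (hB i))
    exact ⟨l, hl.symm⟩
  choose l hl using hl
  have hbdd : BddAbove (Set.range l) := ⟨B, by
    rintro _ ⟨i, rfl⟩
    have := hB i
    rw [hl i] at this
    exact_mod_cast this⟩
  -- A member of maximal length absorbs every other, by directedness.
  obtain ⟨i, hi⟩ := Nat.sSup_mem (Set.range_nonempty l) hbdd
  have hmax : ∀ j, P i ≤ P j → P j ≤ P i := by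
    intro j hij
    have hlj : l j ≤ l i := hi ▸ le_csSup hbdd ⟨j, rfl⟩
    have hfl : IsFiniteLength R (P j) := Module.length_ne_top_iff.mp (by simp [hl j])
    obtain ⟨_, _⟩ := isFiniteLength_iff_isNoetherian_isArtinian.mp hfl
    by_contra hne
    have hlt : (P i).submoduleOf (P j) ≠ ⊤ := by
      rwa [Ne, Submodule.submoduleOf_eq_top]
    have := Submodule.length_lt hlt
    rw [(Submodule.submoduleOfEquivOfLe hij).length_eq, hl i, hl j] at this
    exact absurd (by exact_mod_cast this) (not_lt.mpr hlj)
  have : P i = ⊤ := by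
    refine eq_top_iff.mpr fun x _ => ?_
    obtain ⟨j, hj⟩ := htop x
    obtain ⟨k, hik, hjk⟩ := hP i j
    exact hmax k hik (hjk hj)
  rw [← Module.length_top (R := R), ← this]
  exact hB i

open CategoryTheory in
theorem ModuleCat.length_le_of_isColimit {R : Type*} [Ring R] {J : Type*} [Category* J]
    [IsFiltered J] (G : J ⥤ ModuleCat R) [Limits.PreservesColimit G (forget (ModuleCat R))]
    {c : Limits.Cocone G} (hc : Limits.IsColimit c) (B : ℕ)
    (hB : ∀ j, Module.length R (G.obj j) ≤ B) : Module.length R c.pt ≤ B := by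
  have : Nonempty J := IsFiltered.nonempty
  refine Module.length_le_of_directed (fun j => LinearMap.range (c.ι.app j).hom) ?_ ?_ B ?_
  · intro i j
    refine ⟨IsFiltered.max i j, ?_, ?_⟩
    · dsimp only
      rw [← c.w (IsFiltered.leftToMax i j), ModuleCat.hom_comp]
      exact LinearMap.range_comp_le_range _ _
    · dsimp only
      rw [← c.w (IsFiltered.rightToMax i j), ModuleCat.hom_comp]
      exact LinearMap.range_comp_le_range _ _
  · intro x
    obtain ⟨j, y, hy⟩ := Limits.Concrete.isColimit_exists_rep G hc x
    exact ⟨j, y, hy⟩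
  · intro j
    exact (Module.length_le_of_surjective _ (c.ι.app j).hom.surjective_rangeRestrict).trans (hB j)

open CategoryTheory in
/-- If the submodules of elements of `M` killed by the powers of `J` have bounded length,
the same bound applies to `H⁰_J(M)`. -/
theorem localCohomology.length_zero_le {R : Type u} [CommRing R] (J : Ideal R) (M : ModuleCat.{u} R)
    (B : ℕ) (hB : ∀ (k : ℕ) (N : Submodule R M), (∀ a ∈ J ^ k, ∀ y ∈ N, a • y = 0) →
      Module.length R N ≤ B) :
    Module.length R ((localCohomology J 0).obj M) ≤ B := by
  have := Limits.preservesSmallestFilteredColimits_of_preservesFilteredColimits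
    (forget (ModuleCat.{u} R))
  have := hasColimitDiagram (idealPowersDiagram J) 0
  refine ModuleCat.length_le_of_isColimit _ (Limits.isColimitOfPreserves ((evaluation _ _).obj M)
    (Limits.colimit.isColimit (diagram (idealPowersDiagram J) 0))) B fun j => ?_
  let k : ℕ := j.unop.unop
  let X : ModuleCat R := ModuleCat.of R (R ⧸ J ^ k)
  have e : ((diagram (idealPowersDiagram J) 0).obj j).obj M ≅ ModuleCat.of R (X ⟶ M) :=
    extZeroIso R X M
  change Module.length R (((diagram (idealPowersDiagram J) 0).obj j).obj M) ≤ B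
  rw [e.toLinearEquiv.length_eq]
  -- Evaluation at 1 embeds Hom(R/J^k, M) into the elements of M killed by J^k.
  let ev : (X ⟶ M) →ₗ[R] M :=
    { toFun f := f.hom (Submodule.Quotient.mk (1 : R))
      map_add' _ _ := rfl
      map_smul' _ _ := rfl }
  have hev : Function.Injective ev := by
    intro f g hfg
    refine ModuleCat.hom_ext (LinearMap.ext fun x => ?_)
    obtain ⟨x, rfl⟩ := Submodule.Quotient.mk_surjective _ x
    have hx : (Submodule.Quotient.mk x : R ⧸ J ^ k) = x • Submodule.Quotient.mk (1 : R) := by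
      rw [← Submodule.Quotient.mk_smul, smul_eq_mul, mul_one]
    have h1 : f.hom (Submodule.Quotient.mk (1 : R)) = g.hom (Submodule.Quotient.mk (1 : R)) := hfg
    rw [hx, map_smul, map_smul, h1]
  refine (LinearEquiv.ofInjective ev hev).length_eq.trans_le (hB k _ ?_)
  rintro a ha _ ⟨f, rfl⟩
  change a • f.hom (Submodule.Quotient.mk (1 : R)) = 0
  rw [← map_smul, ← Submodule.Quotient.mk_smul, smul_eq_mul, mul_one,
    (Submodule.Quotient.mk_eq_zero _).mpr ha, map_zero]

/-! ### Extended Rees algebra -/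

/-- The pullback of `Ideal.exists_mem_span_prod_pow_of_mem_pow` along an algebra in which the
ideals `I i` become principal. -/
theorem Ideal.exists_mem_prod_pow_of_algebra {R S : Type*} [CommRing R] [CommRing S] [Algebra R S]
    [IsNoetherianRing S] {ι : Type*} [Fintype ι] (I : ι → Ideal R) (u : ι → S)
    (hu : ∀ i, u i ∈ nonZeroDivisors S)
    (hIu : ∀ i, (I i).map (algebraMap R S) ≤ Ideal.span {u i})
    (huI : ∀ (n : ι → ℕ) (y : R), algebraMap R S y ∈ Ideal.span {∏ i, u i ^ n i} →
      y ∈ ∏ i, I i ^ n i) (J : Ideal R) :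
    ∃ c : ℕ, ∀ (n : ι → ℕ) (y : R), (∃ k, ∀ a ∈ J ^ k, a * y ∈ ∏ i, I i ^ n i) →
      y ∈ J ^ (c * ∑ i, n i) → y ∈ ∏ i, I i ^ n i := by
  obtain ⟨c, hc⟩ := Ideal.exists_mem_span_prod_pow_of_mem_pow u hu (J.map (algebraMap R S))
  refine ⟨c, fun n y ⟨k, hk⟩ hy => huI n y (hc n _ ⟨k, ?_⟩ ?_)⟩
  · have hle : (∏ i, I i ^ n i).map (algebraMap R S) ≤ Ideal.span {∏ i, u i ^ n i} := by
      have h := map_prod (Ideal.mapHom (algebraMap R S)) (fun i => I i ^ n i) Finset.univ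
      simp only [Ideal.mapHom_apply, Ideal.map_pow] at h
      rw [h, ← Ideal.prod_span_singleton]
      refine Finset.prod_le_prod' fun i _ => ?_
      rw [← Ideal.span_singleton_pow]
      exact Ideal.pow_right_mono (hIu i) _
    have h2 : (J.map (algebraMap R S)) ^ k ≤
        (Ideal.span {∏ i, u i ^ n i}).colon {algebraMap R S y} := by
      rw [← Ideal.map_pow, Ideal.map_le_iff_le_comap]
      intro a ha
      rw [Ideal.mem_comap, Submodule.mem_colon_singleton, smul_eq_mul, ← map_mul]
      exact hle (Ideal.mem_map_of_mem _ (hk a ha))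
    intro a ha
    exact Submodule.mem_colon_singleton.mp (h2 ha)
  · rw [← Ideal.map_pow]
    exact Ideal.mem_map_of_mem _ hy

/-- The extended Rees algebra of a family of ideals, as the subalgebra of the multivariate Laurent
polynomials whose coefficient in degree `n` lies in `∏ i, I i ^ n i` (with `I ^ n = ⊤` for
`n ≤ 0`). -/
noncomputable def extendedReesAlgebra {R : Type*} [CommRing R] {ι : Type*} [Fintype ι]
    (I : ι → Ideal R) : Subalgebra R (AddMonoidAlgebra R (ι → ℤ)) where
  carrier := {f | ∀ n, f.coeff n ∈ ∏ i, I i ^ (n i).toNat}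
  zero_mem' n := by simp
  add_mem' hf hg n := by
    rw [AddMonoidAlgebra.coeff_add]
    exact add_mem (hf n) (hg n)
  algebraMap_mem' a n := by
    classical
    rw [AddMonoidAlgebra.coe_algebraMap]
    simp only [Function.comp_apply, AddMonoidAlgebra.coeff_single, Finsupp.single_apply]
    split_ifs with h
    · subst h
      simp [-Ideal.one_eq_top]
    · exact zero_mem _
  mul_mem' {f g} hf hg n := by
    classical
    rw [AddMonoidAlgebra.coeff_mul]
    refine sum_mem fun a _ => sum_mem fun b _ => ?_
    dsimp only
    split_ifs with h
    · subst h
      have hle : (∏ i, I i ^ (a i).toNat) * (∏ i, I i ^ (b i).toNat) ≤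
          ∏ i, I i ^ ((a + b) i).toNat := by
        rw [← Finset.prod_mul_distrib]
        refine Finset.prod_le_prod' fun i _ => ?_
        rw [← pow_add]
        refine Ideal.pow_le_pow_right ?_
        rw [Pi.add_apply]
        omega
      exact hle (Ideal.mul_mem_mul (hf a) (hg b))
    · exact zero_mem _

theorem Ideal.exists_mem_prod_pow_of_mem_pow {R : Type*} [CommRing R]
    [IsNoetherianRing R] {ι : Type*} [Fintype ι] (I : ι → Ideal R) (J : Ideal R) :
    ∃ c : ℕ, ∀ (n : ι → ℕ) (y : R), (∃ k, ∀ a ∈ J ^ k, a * y ∈ ∏ i, I i ^ n i) →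
      y ∈ J ^ (c * ∑ i, n i) → y ∈ ∏ i, I i ^ n i := by
  classical
  choose s hs using fun i => (isNoetherianRing_iff_ideal_fg R).mp inferInstance (I i)
  -- `v i` is t_i⁻¹ and `w i a` is a·t_i. The algebra S they generate is Noetherian because it is
  -- finitely generated; only its inclusion in `extendedReesAlgebra I` is needed.
  let v (i : ι) : AddMonoidAlgebra R (ι → ℤ) := .single (Pi.single i (-1)) 1
  let w (i : ι) (a : R) : AddMonoidAlgebra R (ι → ℤ) := .single (Pi.single i 1) a
  let G : Finset (AddMonoidAlgebra R (ι → ℤ)) :=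
    Finset.univ.image v ∪ Finset.univ.biUnion fun i => (s i).image (w i)
  let S := Algebra.adjoin R (G : Set (AddMonoidAlgebra R (ι → ℤ)))
  have hvS (i : ι) : v i ∈ S := Algebra.subset_adjoin (by simp [G])
  have hwS (i : ι) (a : R) (ha : a ∈ s i) : w i a ∈ S :=
    Algebra.subset_adjoin (Finset.mem_coe.mpr (Finset.mem_union_right _
      (Finset.mem_biUnion.mpr ⟨i, Finset.mem_univ _, Finset.mem_image_of_mem _ ha⟩)))
  have hST : S ≤ extendedReesAlgebra I := by
    refine Algebra.adjoin_le fun f hf => ?_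
    simp only [G, Finset.coe_union, Finset.coe_image, Finset.coe_biUnion, Set.mem_union,
      Set.mem_image, Set.mem_iUnion, Finset.coe_univ, Set.mem_univ, true_and,
      exists_prop] at hf
    rcases hf with ⟨i, rfl⟩ | ⟨i, a, ha, rfl⟩
    · intro n
      simp only [v, AddMonoidAlgebra.coeff_single, Finsupp.single_apply]
      split_ifs with h
      · subst h
        have : ∀ j, ((Pi.single i (-1) : ι → ℤ) j).toNat = 0 := fun j => by
          by_cases hj : j = i
          · subst hj; simp
          · simp [hj]
        simp [this, -Ideal.one_eq_top]
      · exact zero_mem _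
    · intro n
      simp only [w, AddMonoidAlgebra.coeff_single, Finsupp.single_apply]
      split_ifs with h
      · subst h
        rw [Finset.prod_eq_single i (fun j _ hj => by simp [hj]) (by simp)]
        simpa using (hs i ▸ Ideal.subset_span ha : a ∈ I i)
      · exact zero_mem _
  have : Algebra.FiniteType R S := S.fg_iff_finiteType.mp ⟨G, rfl⟩
  have : IsNoetherianRing S := Algebra.FiniteType.isNoetherianRing R S
  let u (i : ι) : S := ⟨v i, hvS i⟩
  have hvw (i : ι) (a : R) : w i a * v i = algebraMap R _ a := by
    rw [AddMonoidAlgebra.single_mul_single, ← Pi.single_add, AddMonoidAlgebra.coe_algebraMap]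
    simp
  refine Ideal.exists_mem_prod_pow_of_algebra (S := S) I u ?_ ?_ ?_ J
  · intro i
    rw [mem_nonZeroDivisors_iff_right]
    intro z hz
    have h1 : (z : AddMonoidAlgebra R (ι → ℤ)) * v i = 0 := congrArg Subtype.val hz
    -- t_i⁻¹ is a unit of the Laurent ring, although t_i need not lie in S.
    have h2 : v i * w i 1 = 1 := by
      rw [mul_comm, hvw, map_one]
    refine Subtype.ext ?_
    calc (z : AddMonoidAlgebra R (ι → ℤ)) = z * v i * w i 1 := by rw [mul_assoc, h2, mul_one]
      _ = 0 := by rw [h1, zero_mul]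
  · intro i
    rw [← hs i, Ideal.map_span, Ideal.span_le]
    rintro _ ⟨a, ha, rfl⟩
    exact Ideal.mem_span_singleton'.mpr ⟨⟨w i a, hwS i a ha⟩, Subtype.ext (hvw i a)⟩
  · intro n y hy
    obtain ⟨z, hz⟩ := Ideal.mem_span_singleton'.mp hy
    have hprod : ∏ i, v i ^ n i = .single (fun i => -(n i : ℤ)) 1 := by
      have h1 : ∀ i, v i ^ n i = AddMonoidAlgebra.of R (ι → ℤ)
          (Multiplicative.ofAdd (Pi.single i (-(n i : ℤ)))) := fun i => by
        simp [v, AddMonoidAlgebra.single_pow, ← Pi.single_smul]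
      simp_rw [h1]
      rw [← map_prod, ← ofAdd_sum, Finset.univ_sum_single]
      rfl
    have h : (z : AddMonoidAlgebra R (ι → ℤ)) * .single (fun i => -(n i : ℤ)) 1 =
        algebraMap R _ y := by
      rw [← hprod]
      simpa [u] using congrArg Subtype.val hz
    -- Comparing degree 0 in z·t⁻ⁿ = y shows that y is the degree n coefficient of z.
    have h0 := congrArg (fun f => f.coeff 0) h
    have h3 := hST z.2 (fun i => (n i : ℤ))
    simp only [Int.toNat_natCast] at h3
    convert h3 using 1
    simpa [AddMonoidAlgebra.coe_algebraMap, Pi.neg_def] using h0.symm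

/-! ### Conclusion -/

/-- If `A ⊓ K ≤ Q`, then the image of `A` in `R ⧸ Q` has length at most that of `R ⧸ K`. -/
theorem Ideal.length_le_length_quotient_of_comap_inf_le {R : Type*} [CommRing R] (Q K : Ideal R)
    (N : Submodule R (R ⧸ Q)) (h : N.comap Q.mkQ ⊓ K ≤ Q) :
    Module.length R N ≤ Module.length R (R ⧸ K) := by
  let A : Ideal R := N.comap Q.mkQ
  let f : A →ₗ[R] N := Q.mkQ.restrict fun _ ha => ha
  have hf : Function.Surjective f := by
    rintro ⟨x, hx⟩
    obtain ⟨a, rfl⟩ := Q.mkQ_surjective x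
    exact ⟨⟨a, hx⟩, rfl⟩
  let g : A →ₗ[R] R ⧸ K := K.mkQ ∘ₗ A.subtype
  have hgf : LinearMap.ker g ≤ LinearMap.ker f := by
    intro a ha
    have haK : (a : R) ∈ K := (Submodule.Quotient.mk_eq_zero K).mp ha
    exact Subtype.ext ((Submodule.Quotient.mk_eq_zero Q).mpr (h ⟨a.2, haK⟩))
  calc Module.length R N
      ≤ Module.length R (A ⧸ LinearMap.ker g) :=
        Module.length_le_of_surjective ((LinearMap.ker g).liftQ f hgf) fun y => by
          obtain ⟨a, rfl⟩ := hf y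
          exact ⟨Submodule.Quotient.mk a, rfl⟩
    _ = Module.length R (LinearMap.range g) := g.quotKerEquivRange.length_eq
    _ ≤ Module.length R (R ⧸ K) :=
        Module.length_le_of_injective _ (LinearMap.range g).injective_subtype

theorem theorem5p1 {R : Type*} [CommRing R] [IsLocalRing R] [IsNoetherianRing R]
    (d : ℕ) (hd : ringKrullDim R = (d : WithBot ℕ∞)) (r : ℕ) (I : Fin r → Ideal R) :
    ∃ F : MvPolynomial (Fin r) ℚ, F.IsNumerical ∧ F.totalDegree ≤ d ∧
      ∃ N : ℕ, ∀ n : Fin r → ℕ, (∀ i, N ≤ n i) →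
        ∃ l : ℕ,
          Module.length R
            ((localCohomology (IsLocalRing.maximalIdeal R) 0).obj
              (ModuleCat.of R (R ⧸ ∏ i, I i ^ n i))) = (l : ℕ∞) ∧
          (l : ℚ) ≤ MvPolynomial.eval (fun i => (n i : ℚ)) F := by
  obtain ⟨c, hc⟩ := Ideal.exists_mem_prod_pow_of_mem_pow I (IsLocalRing.maximalIdeal R)
  obtain ⟨C, hC⟩ := IsLocalRing.exists_length_quotient_maximalIdeal_pow_le d hd
  let F : MvPolynomial (Fin r) ℚ :=
    MvPolynomial.C (C : ℚ) * (MvPolynomial.C (c : ℚ) * ∑ i, MvPolynomial.X i) ^ d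
  have hF (x : Fin r → ℚ) : MvPolynomial.eval x F = C * (c * ∑ i, x i) ^ d := by
    simp [F]
  -- The bound holds for every exponent vector, so N = 0.
  refine ⟨F, fun n => ⟨C * (c * ∑ i, n i) ^ d, ?_⟩, ?_, 0, fun n _ => ?_⟩
  · rw [hF]
    push_cast
    rfl
  · have h1 : (∑ i, MvPolynomial.X i : MvPolynomial (Fin r) ℚ).totalDegree ≤ 1 :=
      MvPolynomial.totalDegree_finsetSum_le fun i _ => (MvPolynomial.totalDegree_X i).le
    have h2 := MvPolynomial.totalDegree_mul (MvPolynomial.C (c : ℚ))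
      (∑ i, MvPolynomial.X i : MvPolynomial (Fin r) ℚ)
    rw [MvPolynomial.totalDegree_C, zero_add] at h2
    refine (MvPolynomial.totalDegree_mul _ _).trans ?_
    rw [MvPolynomial.totalDegree_C, zero_add]
    refine (MvPolynomial.totalDegree_pow _ _).trans ?_
    simpa using Nat.mul_le_mul_left d (h2.trans h1)
  · have hlen := localCohomology.length_zero_le (IsLocalRing.maximalIdeal R)
      (ModuleCat.of R (R ⧸ ∏ i, I i ^ n i)) (C * (c * ∑ i, n i) ^ d) fun k N hN =>
        (Ideal.length_le_length_quotient_of_comap_inf_le _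
          (IsLocalRing.maximalIdeal R ^ (c * ∑ i, n i)) N fun y hy =>
            hc n y ⟨k, fun a ha => (Submodule.Quotient.mk_eq_zero _).mp (hN a ha _ hy.1)⟩
              hy.2).trans (hC _)
    obtain ⟨l, hl⟩ := ENat.ne_top_iff_exists.mp
      (ne_top_of_le_ne_top (ENat.natCast_ne_top _) hlen)
    refine ⟨l, hl.symm, ?_⟩
    rw [← hl] at hlen
    rw [hF]
    exact_mod_cast hlen
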